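/- For $a\in\mathbb Z$ and $n\ge 1$ let $\left(\frac{a}{n}\right)$ be the Jacobi symbol, extended to even $n$ as the Kronecker symbol (multiplicative in $n$, with $\left(\frac a2\right)=0,1,-1$ according as $a$ is even, $a\equiv\pm1$, $a\equiv\pm3 \pmod 8$). For a commutative ring $R$ and $g_1,g_2\in R[x]$, $\mathrm{gcmd}(g_1,g_2)$ denotes the monic polynomial $h\in R[x]$, if it exists, with $(g_1,g_2)=(h)$ as ideals of $R[x]$. Let $n$ be composite. A monic $f\in\mathbb Z[x]$ of degree $2$ with discriminant $\Delta$ is a *degree-2 Frobenius liar* with respect to $n$ if: (1) $\gcd(n,f(0)\Delta)=1$; (2) in $(\mathbb Z/n\mathbb Z)[x]$ the polynomials $F_1=\mathrm{gcmd}(x^n-x,f)$, $f_1=f/F_1$, $F_2=\mathrm{gcmd}(x^{n^2}-x,f_1)$, $f_2=f_1/F_2$ exist and $f_2=1$; (3) $F_2(x)\mid F_2(x^n)$; (4) $(-1)^S=\left(\frac{\Delta}{n}\right)$, where $S=\deg(F_2)/2$. Let $L_2^+(n)$ be the number of polynomials $f \bmod n$ that come from degree-2 Frobenius liars with $\left(\frac{\Delta}{n}\right)=1$.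 **Theorem.** Let $n=\prod_i p_i^{r_i}$ be a composite integer, and for each prime $p\mid n$ put $$L_2^{++}(n,p)=\tfrac12\left(\gcd(n-1,p-1)^2-\gcd(n-1,p-1)\right),\qquad L_2^{+-}(n,p)=\tfrac12\left(\gcd(n-1,p^2-1)-\gcd(n-1,p-1)\right).$$ (a) For each $i$, $L_2^{++}(n,p_i)$ (respectively $L_2^{+-}(n,p_i)$) is the number of monic quadratic polynomials over $\mathbb Z/p_i^{r_i}\mathbb Z$, represented by $f\in\mathbb Z[x]$ with discriminant $\Delta$, such that $p_i\nmid \Delta$, $p_i\nmid f(0)$, $\mathrm{gcmd}(x^n-x,f)=f$ modulo $p_i^{r_i}$, and $\left(\frac{\Delta}{p_i}\right)=1$ (respectively $-1$). (b) One has $$L_2^+(n)=\frac12\prod_{i}\left(L_2^{++}(n,p_i)+L_2^{+-}(n,p_i)\right)+\frac12\prod_{2\mid r_i}\left(L_2^{++}(n,p_i)+L_2^{+-}(n,p_i)\right)\prod_{2\nmid r_i}\left(L_2^{++}(n,p_i)-L_2^{+-}(n,p_i)\right).$$ (c) If $n$ is moreover squarefree, then $$L_2^+(n)=\frac12\prod_{p\mid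 n}\frac12\left(\gcd(n-1,p^2-1)+\gcd(n-1,p-1)^2-2\gcd(n-1,p-1)\right)+\frac12\prod_{p\mid n}\frac12\left(\gcd(n-1,p-1)^2-\gcd(n-1,p^2-1)\right).$$ -/

import Mathlib

open Polynomial

/-- The Kronecker symbol `(a / n)` for `n ≥ 1`: with `n = 2 ^ k * m` and `m` odd it is
`(a / 2) ^ k * (a / m)`, where `(a / m)` is the Jacobi symbol and `(a / 2)` is `0` for even `a`,
`1` for `a ≡ ±1 (mod 8)` and `-1` for `a ≡ ±3 (mod 8)`. -/
def kroneckerSymbol (a : ℤ) (n : ℕ) : ℤ :=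
  ZMod.χ₈ (a : ZMod 8) ^ padicValNat 2 n * jacobiSym a (n / 2 ^ padicValNat 2 n)

/-- For odd `n` the Kronecker symbol is the Jacobi symbol. -/
theorem kroneckerSymbol_of_odd (a : ℤ) {n : ℕ} (hn : Odd n) :
    kroneckerSymbol a n = jacobiSym a n := by
  have h : padicValNat 2 n = 0 :=
    padicValNat.eq_zero_of_not_dvd (by
      obtain ⟨k, rfl⟩ := hn
      omega)
  simp [kroneckerSymbol, h]

/-- `h` is the greatest common monic divisor of `g₁` and `g₂`: it is monic and generates the ideal
generated by `g₁` and `g₂`. It need not exist. -/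
def IsGCMD {R : Type*} [CommRing R] (g₁ g₂ h : R[X]) : Prop :=
  h.Monic ∧ Ideal.span {g₁, g₂} = Ideal.span {h}

/-- The reduction of an integer polynomial modulo `m`. -/
noncomputable def reduceMod (m : ℕ) (f : ℤ[X]) : (ZMod m)[X] :=
  f.map (Int.castRingHom (ZMod m))

/-- `n` is a degree-2 Frobenius pseudoprime with respect to `f`, that is, `f` is a degree-2
Frobenius liar with respect to `n`. -/
structure IsDegreeTwoFrobeniusLiar (n : ℕ) (f : ℤ[X]) : Prop where
  one_lt : 1 < n
  not_prime : ¬ n.Prime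
  monic : f.Monic
  natDegree_eq : f.natDegree = 2
  /-- Integer Divisibility -/
  gcd_eq_one : Int.gcd (n : ℤ) (f.eval 0 * f.discr) = 1
  /-- Factorization, Frobenius and Jacobi. The last line says `(-1) ^ S = (Δ / n)` with
  `S = deg F₂ / 2`; for odd `deg F₂` the number `(-1) ^ S` would not be `±1`. -/
  steps : ∃ F₁ f₁ F₂ f₂ : (ZMod n)[X],
    (IsGCMD (X ^ n - X) (reduceMod n f) F₁ ∧ reduceMod n f = F₁ * f₁ ∧
      IsGCMD (X ^ (n ^ 2) - X) f₁ F₂ ∧ f₁ = F₂ * f₂ ∧ f₂ = 1) ∧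
    F₂ ∣ F₂.comp (X ^ n) ∧
    ∃ S : ℕ, F₂.natDegree = 2 * S ∧ (-1 : ℤ) ^ S = kroneckerSymbol f.discr n

/-- The polynomials modulo `n` that are (reductions of) degree-2 Frobenius liars with respect to
`n` with `(Δ / n) = 1`. -/
def frobeniusLiarsPlus (n : ℕ) : Set (ZMod n)[X] :=
  {g | ∃ f : ℤ[X], IsDegreeTwoFrobeniusLiar n f ∧ kroneckerSymbol f.discr n = 1 ∧
    reduceMod n f = g}

/-- The monic quadratic polynomials modulo `p ^ r` with `(Δ / p) = ε` that satisfy at `p` the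
conditions for a degree-2 Frobenius pseudoprime in the case `(Δ / n) = 1`: `Δ` and `f(0)` are not
divisible by `p`, and `gcmd(x ^ n - x, f) = f` modulo `p ^ r`. -/
def localFrobeniusLiarsPlus (n p r : ℕ) (ε : ℤ) : Set (ZMod (p ^ r))[X] :=
  {g | ∃ f : ℤ[X], f.Monic ∧ f.natDegree = 2 ∧ ¬ (p : ℤ) ∣ f.discr ∧ ¬ (p : ℤ) ∣ f.eval 0 ∧
    kroneckerSymbol f.discr p = ε ∧
    IsGCMD (X ^ n - X) (reduceMod (p ^ r) f) (reduceMod (p ^ r) f) ∧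
    reduceMod (p ^ r) f = g}

/-- `L₂⁺⁺(n, p)` -/
def liarCountPlusPlus (n p : ℕ) : ℚ :=
  (1 / 2) * ((Nat.gcd (n - 1) (p - 1) : ℚ) ^ 2 - (Nat.gcd (n - 1) (p - 1) : ℚ))

/-- `L₂⁺⁻(n, p)` -/
def liarCountPlusMinus (n p : ℕ) : ℚ :=
  (1 / 2) * ((Nat.gcd (n - 1) (p ^ 2 - 1) : ℚ) - (Nat.gcd (n - 1) (p - 1) : ℚ))

/-! When `(Δ / n) = 1`, the sign condition forces `F₂ = 1`, since `deg F₂ = 2` would give `S = 1`.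
The liars are then the quadratics `f ∣ X ^ n - X` with `f(0)` and `Δ` units and `(Δ / n) = 1`
(`frobeniusLiarsPlus_eq_image`). As `(1 + ε) / 2` is the indicator of `ε = 1` among signs, twice
their number is the sum of `(Δ / n) ^ 0` plus the sum of `(Δ / n) ^ 1` over all unit-discriminant,
unit-constant quadratic divisors modulo `n`.

By the Chinese remainder theorem both sums are products over the prime powers `p ^ r` exactly
dividing `n` (`liarSum_eq_prod`). Modulo `p ^ r` the derivative of `X ^ n - X` is `-1`, so Hensel
lifting matches the quadratic divisors modulo `p ^ r` with those modulo `p` (`bijOn_liarPair_pow`),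
while the symbol becomes an `r`-th power. This is where the parity of `r` enters.

Over the field with `p` elements, split divisors are unordered pairs of distinct solutions of `a ^
(n - 1) = 1`, and irreducible ones are conjugate pairs of solutions in the quadratic extension
outside the prime field. Cyclicity of the unit groups turns these counts into gcds. -/

/-! ### Monic quadratics as coefficient pairs. -/

section QuadraticPairs

variable {R S : Type*} [CommRing R] [CommRing S]

/-- The monic quadratic polynomial `X ^ 2 + b X + c` attached to the pair `(b, c)`. -/
noncomputable def quadPoly (x : R × R) : R[X] := X ^ 2 + C x.1 * X + C x.2

theorem quadPoly_eq (x : R × R) : quadPoly x = C 1 * X ^ 2 + C x.1 * X + C x.2 := by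
  simp [quadPoly]

theorem quadPoly_coeff_zero (x : R × R) : (quadPoly x).coeff 0 = x.2 := by
  simp [quadPoly]

theorem quadPoly_coeff_one (x : R × R) : (quadPoly x).coeff 1 = x.1 := by
  simp [quadPoly, coeff_X_pow, coeff_C]

theorem quadPoly_injective : Function.Injective (quadPoly : R × R → R[X]) := by
  intro x y h
  ext
  · rw [← quadPoly_coeff_one, h, quadPoly_coeff_one]
  · rw [← quadPoly_coeff_zero, h, quadPoly_coeff_zero]

theorem natDegree_quadPoly [Nontrivial R] (x : R × R) : (quadPoly x).natDegree = 2 := by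
  rw [quadPoly_eq]
  exact natDegree_quadratic one_ne_zero

theorem monic_quadPoly (x : R × R) : (quadPoly x).Monic := by
  nontriviality R
  rw [Monic, quadPoly_eq]
  exact leadingCoeff_quadratic one_ne_zero

theorem map_quadPoly (φ : R →+* S) (x : R × R) :
    (quadPoly x).map φ = quadPoly (Prod.map φ φ x) := by
  simp [quadPoly]

theorem eq_quadPoly_of_monic {f : R[X]} (hf : f.Monic) (h2 : f.natDegree = 2) :
    f = quadPoly (f.coeff 1, f.coeff 0) := by
  have h := hf.coeff_natDegree
  rw [h2] at h
  ext i
  rcases i with _ | _ | _ | i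
  · rw [quadPoly_coeff_zero]
  · rw [quadPoly_coeff_one]
  · simp [quadPoly, h]
  · rw [coeff_eq_zero_of_natDegree_lt (by omega)]
    simp [quadPoly, coeff_X_pow]

theorem eval_quadPoly (x : R × R) (t : R) : (quadPoly x).eval t = t ^ 2 + x.1 * t + x.2 := by
  simp [quadPoly]

theorem discr_eq_of_monic [Nontrivial R] {f : R[X]} (hf : f.Monic) (h2 : f.natDegree = 2) :
    f.discr = f.coeff 1 ^ 2 - 4 * f.coeff 0 := by
  have h := hf.coeff_natDegree
  rw [h2] at h
  rw [discr_of_degree_eq_two (by rw [degree_eq_natDegree hf.ne_zero, h2]; rfl), h, mul_one]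

/-- The pairs `(b, c)` such that `c` and the discriminant of `X ^ 2 + b X + c` are units and
`X ^ 2 + b X + c` divides `X ^ n - X`. -/
def IsLiarPair (n : ℕ) (x : R × R) : Prop :=
  IsUnit (x.1 ^ 2 - 4 * x.2) ∧ IsUnit x.2 ∧ quadPoly x ∣ X ^ n - X

theorem IsLiarPair.map {n : ℕ} {x : R × R} (h : IsLiarPair n x) (φ : R →+* S) :
    IsLiarPair n (Prod.map φ φ x) := by
  refine ⟨by simpa [map_ofNat] using h.1.map φ, h.2.1.map φ, ?_⟩
  have := map_dvd (mapRingHom φ) h.2.2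
  simpa [map_quadPoly] using this

/-- The remainder on division by a monic polynomial commutes with base change, so each of its
coefficients is killed by both maps. -/
theorem Polynomial.Monic.dvd_of_map_dvd {T : Type*} [CommRing T] {φ : R →+* S} {ψ : R →+* T}
    (hinj : ∀ r, φ r = 0 → ψ r = 0 → r = 0) {p q : R[X]} (hq : q.Monic)
    (h₁ : q.map φ ∣ p.map φ) (h₂ : q.map ψ ∣ p.map ψ) : q ∣ p := by
  rw [← modByMonic_eq_zero_iff_dvd hq]
  rw [← modByMonic_eq_zero_iff_dvd (hq.map _), ← map_modByMonic _ hq] at h₁ h₂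
  ext i
  apply hinj
  · simpa using congrArg (fun r => r.coeff i) h₁
  · simpa using congrArg (fun r => r.coeff i) h₂

theorem isLiarPair_iff_of_equiv_prod {T : Type*} [CommRing T] (e : R ≃+* S × T) (n : ℕ)
    (x : R × R) :
    IsLiarPair n x ↔ IsLiarPair n ((e x.1).1, (e x.2).1) ∧ IsLiarPair n ((e x.1).2, (e x.2).2) := by
  set φ : R →+* S := (RingHom.fst S T).comp e.toRingHom with hφ
  set ψ : R →+* T := (RingHom.snd S T).comp e.toRingHom with hψ
  have hunit : ∀ r : R, IsUnit (φ r) → IsUnit (ψ r) → IsUnit r := fun r h₁ h₂ =>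
    (MulEquiv.isUnit_map e).1 (Prod.isUnit_iff.2 ⟨h₁, h₂⟩)
  change _ ↔ IsLiarPair n (Prod.map φ φ x) ∧ IsLiarPair n (Prod.map ψ ψ x)
  refine ⟨fun h => ⟨h.map φ, h.map ψ⟩, fun ⟨h, h'⟩ => ⟨?_, ?_, ?_⟩⟩
  · exact hunit _ (by simpa [map_ofNat] using h.1) (by simpa [map_ofNat] using h'.1)
  · exact hunit _ h.2.1 h'.2.1
  · refine (monic_quadPoly x).dvd_of_map_dvd (φ := φ) (ψ := ψ) (fun r h₁ h₂ => ?_) ?_ ?_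
    · exact (map_eq_zero_iff e e.injective).1 (Prod.ext h₁ h₂)
    · simpa [map_quadPoly] using h.2.2
    · simpa [map_quadPoly] using h'.2.2

end QuadraticPairs

/-! ### The Kronecker symbol of a discriminant modulo `m`. -/

section Kronecker

theorem kroneckerSymbol_mul_right (a : ℤ) {m n : ℕ} (hm : m ≠ 0) (hn : n ≠ 0) :
    kroneckerSymbol a (m * n) = kroneckerSymbol a m * kroneckerSymbol a n := by
  have hdm : 2 ^ padicValNat 2 m ∣ m := pow_padicValNat_dvd
  have hdn : 2 ^ padicValNat 2 n ∣ n := pow_padicValNat_dvd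
  have h1 : m / 2 ^ padicValNat 2 m ≠ 0 :=
    (Nat.div_pos (Nat.le_of_dvd (by omega) hdm) (by positivity)).ne'
  have h2 : n / 2 ^ padicValNat 2 n ≠ 0 :=
    (Nat.div_pos (Nat.le_of_dvd (by omega) hdn) (by positivity)).ne'
  have : NeZero (m / 2 ^ padicValNat 2 m) := ⟨h1⟩
  have : NeZero (n / 2 ^ padicValNat 2 n) := ⟨h2⟩
  rw [kroneckerSymbol, kroneckerSymbol, kroneckerSymbol, padicValNat.mul hm hn, pow_add, pow_add,
    ← Nat.div_mul_div_comm hdm hdn, jacobiSym.mul_right]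
  ring

theorem kroneckerSymbol_one_right (a : ℤ) : kroneckerSymbol a 1 = 1 := by
  simp [kroneckerSymbol]

theorem kroneckerSymbol_pow_right (a : ℤ) {m : ℕ} (hm : m ≠ 0) (k : ℕ) :
    kroneckerSymbol a (m ^ k) = kroneckerSymbol a m ^ k := by
  induction k with
  | zero => simp [kroneckerSymbol_one_right]
  | succ k ih => rw [pow_succ, kroneckerSymbol_mul_right a (pow_ne_zero _ hm) hm, ih, pow_succ]

/-- `χ₈` has period 8, yet on discriminants it only sees `b` and `c` modulo 2. The term `4c` modulo
8 depends on the parity of `c`. For odd `b` the square is 1 modulo 8, and for even `b` the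
discriminant is even and the value is 0. -/
theorem chi_eight_discr_congr {b b' c c' : ℤ} (hb : b ≡ b' [ZMOD 2]) (hc : c ≡ c' [ZMOD 2]) :
    ZMod.χ₈ ((b ^ 2 - 4 * c : ℤ) : ZMod 8) = ZMod.χ₈ ((b' ^ 2 - 4 * c' : ℤ) : ZMod 8) := by
  obtain ⟨k, hk⟩ := hb.dvd
  obtain ⟨l, hl⟩ := hc.dvd
  obtain rfl : b' = b + 2 * k := by linarith
  obtain rfl : c' = c + 2 * l := by linarith
  push_cast
  generalize (b : ZMod 8) = b
  generalize (c : ZMod 8) = c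
  generalize (k : ZMod 8) = k
  have : ∀ l : ZMod 8, b ^ 2 - 4 * c = b ^ 2 - 4 * (c + 2 * l) := by revert b c; decide
  have h2 : ∀ b c k : ZMod 8, ZMod.χ₈ (b ^ 2 - 4 * c) = ZMod.χ₈ ((b + 2 * k) ^ 2 - 4 * c) := by
    decide
  rw [this l, h2 _ _ k]

theorem kroneckerSymbol_discr_congr {m : ℕ} {b b' c c' : ℤ} (hb : b ≡ b' [ZMOD m])
    (hc : c ≡ c' [ZMOD m]) :
    kroneckerSymbol (b ^ 2 - 4 * c) m = kroneckerSymbol (b' ^ 2 - 4 * c') m := by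
  have hd : ((m / 2 ^ padicValNat 2 m : ℕ) : ℤ) ∣ m :=
    Int.natCast_dvd_natCast.2 (Nat.div_dvd_of_dvd pow_padicValNat_dvd)
  have hJ : jacobiSym (b ^ 2 - 4 * c) (m / 2 ^ padicValNat 2 m) =
      jacobiSym (b' ^ 2 - 4 * c') (m / 2 ^ padicValNat 2 m) :=
    jacobiSym.mod_left' (((hb.pow 2).sub (hc.mul_left 4)).of_dvd hd)
  rw [kroneckerSymbol, kroneckerSymbol, hJ]
  by_cases h2 : 2 ∣ m
  · have h2' : (2 : ℤ) ∣ m := by exact_mod_cast h2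
    rw [chi_eight_discr_congr (hb.of_dvd h2') (hc.of_dvd h2')]
  · rw [padicValNat.eq_zero_of_not_dvd h2, pow_zero, pow_zero, pow_zero]

/-- The Kronecker symbol `(Δ / m)` of the discriminant of `X ^ 2 + b X + c`, for `b` and `c`
modulo `m`. -/
def discrSymbol (m : ℕ) (x : ZMod m × ZMod m) : ℤ :=
  kroneckerSymbol ((x.1.cast : ℤ) ^ 2 - 4 * (x.2.cast : ℤ)) m

theorem discrSymbol_intCast (m : ℕ) (b c : ℤ) :
    discrSymbol m ((b : ZMod m), (c : ZMod m)) = kroneckerSymbol (b ^ 2 - 4 * c) m := by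
  apply kroneckerSymbol_discr_congr <;> rw [← ZMod.intCast_eq_intCast_iff] <;> simp

theorem exists_intCast_pair {m : ℕ} (x : ZMod m × ZMod m) :
    ∃ b c : ℤ, x = ((b : ZMod m), (c : ZMod m)) := by
  obtain ⟨b, hb⟩ := ZMod.intCast_surjective x.1
  obtain ⟨c, hc⟩ := ZMod.intCast_surjective x.2
  exact ⟨b, c, by rw [hb, hc]⟩

end Kronecker

/-! ### Character sums over liar pairs and the Chinese remainder theorem. -/

section Multiplicativity

open Classical in
/-- The sum of `(Δ / m) ^ j` over the liar pairs modulo `m`. -/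
noncomputable def liarSum (n j m : ℕ) : ℤ :=
  ∑ᶠ x : ZMod m × ZMod m, if IsLiarPair n x then discrSymbol m x ^ j else 0

open Classical in
theorem liarSum_eq_sum (n j m : ℕ) [NeZero m] :
    liarSum n j m = ∑ x : ZMod m × ZMod m, if IsLiarPair n x then discrSymbol m x ^ j else 0 :=
  finsum_eq_sum_of_fintype _

theorem liarSum_one (n j : ℕ) : liarSum n j 1 = 1 := by
  classical
  rw [liarSum_eq_sum, Fintype.sum_subsingleton _ (0, 0)]
  rw [if_pos, discrSymbol, kroneckerSymbol_one_right, one_pow]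
  refine ⟨isUnit_of_subsingleton _, isUnit_of_subsingleton _, ?_⟩
  rw [Subsingleton.elim (X ^ n - X : (ZMod 1)[X]) 0]
  exact dvd_zero _

theorem liarSum_mul (n j : ℕ) {a b : ℕ} [NeZero a] [NeZero b] (hab : a.Coprime b) :
    liarSum n j (a * b) = liarSum n j a * liarSum n j b := by
  classical
  have : NeZero (a * b) := ⟨mul_ne_zero (NeZero.ne a) (NeZero.ne b)⟩
  set e := ZMod.chineseRemainder hab
  rw [liarSum_eq_sum, liarSum_eq_sum, liarSum_eq_sum, Finset.sum_mul_sum, ← Fintype.sum_prod_type']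
  refine Fintype.sum_equiv ((e.toEquiv.prodCongr e.toEquiv).trans (Equiv.prodProdProdComm _ _ _ _))
    _ _ fun x => ?_
  have hx : discrSymbol (a * b) x =
      discrSymbol a ((e x.1).1, (e x.2).1) * discrSymbol b ((e x.1).2, (e x.2).2) := by
    obtain ⟨s, t, rfl⟩ := exists_intCast_pair x
    simp only [map_intCast, Prod.fst_intCast, Prod.snd_intCast, discrSymbol_intCast]
    exact kroneckerSymbol_mul_right _ (NeZero.ne a) (NeZero.ne b)
  change _ = (if IsLiarPair n ((e x.1).1, (e x.2).1) then
      discrSymbol a ((e x.1).1, (e x.2).1) ^ j else 0) *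
    (if IsLiarPair n ((e x.1).2, (e x.2).2) then discrSymbol b ((e x.1).2, (e x.2).2) ^ j else 0)
  rw [if_congr (isLiarPair_iff_of_equiv_prod e n x) rfl rfl, ite_zero_mul_ite_zero, ← mul_pow,
    ← hx]

theorem liarSum_eq_prod (n j : ℕ) {m : ℕ} (hm : m ≠ 0) :
    liarSum n j m = ∏ p ∈ m.primeFactors, liarSum n j (p ^ m.factorization p) := by
  rw [Nat.multiplicative_factorization (liarSum n j) (fun a b hab => ?_) (liarSum_one n j) hm]
  · rfl
  -- `liarSum_mul` needs nonzero moduli, but 0 is coprime only to 1, where the sum is 1.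
  · rcases eq_or_ne a 0 with rfl | ha
    · obtain rfl : b = 1 := by simpa using hab
      simp [liarSum_one]
    rcases eq_or_ne b 0 with rfl | hb
    · obtain rfl : a = 1 := by simpa using hab
      simp [liarSum_one]
    have : NeZero a := ⟨ha⟩
    have : NeZero b := ⟨hb⟩
    exact liarSum_mul n j hab

end Multiplicativity

/-! ### Existence and uniqueness of lifts of factors. -/

section Hensel

theorem C_natCast_dvd_iff_reduceMod_eq_zero {m : ℕ} {f : ℤ[X]} :
    C (m : ℤ) ∣ f ↔ reduceMod m f = 0 := by
  rw [C_dvd_iff_dvd_coeff]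
  simp [Polynomial.ext_iff, reduceMod, ZMod.intCast_zmod_eq_zero_iff_dvd]

theorem reduceMod_surjective (m : ℕ) : Function.Surjective (reduceMod m) :=
  map_surjective _ (ZMod.ringHom_surjective _)

/-- Hensel lifting of a factorization of a polynomial that is separable modulo `p`. -/
theorem exists_factor_lift {p : ℕ} {P G₀ H₀ : ℤ[X]} (hP : (reduceMod p P).Separable)
    (hG₀ : G₀.Monic) (h₀ : C (p : ℤ) ∣ P - G₀ * H₀) (k : ℕ) :
    ∃ G H : ℤ[X], G.Monic ∧ G.natDegree = G₀.natDegree ∧ C (p : ℤ) ∣ G - G₀ ∧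
      C (p : ℤ) ^ (k + 1) ∣ P - G * H := by
  induction k with
  | zero => exact ⟨G₀, H₀, hG₀, rfl, by simp, by simpa using h₀⟩
  | succ k ih =>
    obtain ⟨G, H, hG, hdeg, hGG, E, hE⟩ := ih
    have hfac : reduceMod p P = reduceMod p G * reduceMod p H := by
      have : C (p : ℤ) ∣ P - G * H := ⟨C (p : ℤ) ^ k * E, by rw [hE]; ring⟩
      rw [C_natCast_dvd_iff_reduceMod_eq_zero] at this
      simpa [reduceMod, sub_eq_zero] using this
    -- The factors of a separable product are coprime, which gives a Bézout relation modulo `p` to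
    -- lift to integer coefficients.
    obtain ⟨s', t', hst⟩ := (hfac ▸ hP).isCoprime
    obtain ⟨s, rfl⟩ := reduceMod_surjective p s'
    obtain ⟨t, rfl⟩ := reduceMod_surjective p t'
    obtain ⟨w, hw⟩ : C (p : ℤ) ∣ s * G + t * H - 1 := by
      rw [C_natCast_dvd_iff_reduceMod_eq_zero]
      simpa [reduceMod, sub_eq_zero] using hst
    -- The corrections `u` to `G` and `v` to `H` must satisfy `u * H + v * G ≡ E` modulo `p`. Bézout
    -- suggests `E * t` and `s * E`; reducing the former modulo `G` keeps the new factor monic of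
    -- the same degree, and the quotient moves into `v = s * E + q * H`.
    have hq := modByMonic_add_div (E * t) G
    set u := (E * t) %ₘ G with hu
    set q := (E * t) /ₘ G
    have hlt : (C (p : ℤ) ^ (k + 1) * u).degree < G.degree := by
      rw [← C_pow, ← smul_eq_C_mul]
      exact (degree_smul_le _ _).trans_lt (degree_modByMonic_lt _ hG)
    refine ⟨G + C (p : ℤ) ^ (k + 1) * u, H + C (p : ℤ) ^ (k + 1) * (s * E + q * H),
      hG.add_of_left hlt, ?_, ?_, ?_⟩
    · rw [natDegree_add_eq_left_of_degree_lt hlt, hdeg]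
    · obtain ⟨v, hv⟩ := hGG
      exact ⟨v + C (p : ℤ) ^ k * u, by linear_combination hv⟩
    · refine ⟨-(E * w) - C (p : ℤ) ^ k * (u * (s * E + q * H)), ?_⟩
      linear_combination hE - C (p : ℤ) ^ (k + 1) * H * hq - C (p : ℤ) ^ (k + 1) * E * hw

variable {R S : Type*} [CommRing R] [CommRing S]

theorem isNilpotent_of_map_eq_zero {φ : R →+* S} (hφ : ∀ r, φ r = 0 → IsNilpotent r) {f : R[X]}
    (hf : f.map φ = 0) : IsNilpotent f := by
  rw [Polynomial.isNilpotent_iff]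
  intro i
  apply hφ
  rw [← coeff_map, hf, coeff_zero]

/-- Write `q` as `quadPoly x * h` and as `quadPoly y * h'`. Modulo nilpotents `h` and `h'` agree, so
a Bézout relation for `quadPoly x` and `h` becomes a unit when `h` is replaced by `h'`. Thus
`quadPoly x` is coprime to `h'` and divides `quadPoly y`; both are monic of the same degree. -/
theorem degree_two_divisor_unique {φ : R →+* S} (hφ : ∀ r, φ r = 0 → IsNilpotent r) {q : R[X]}
    (hq : q.Separable) {x y : R × R} (hx : quadPoly x ∣ q) (hy : quadPoly y ∣ q)
    (hxy : Prod.map φ φ x = Prod.map φ φ y) : x = y := by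
  nontriviality R
  obtain ⟨h, rfl⟩ := hx
  obtain ⟨h', hh'⟩ := hy
  have hmap : (h' - h).map φ = 0 := by
    rw [Polynomial.map_sub, sub_eq_zero]
    apply ((monic_quadPoly x).map φ).isRegular.left
    have := congrArg (Polynomial.map φ) hh'
    rw [Polynomial.map_mul, Polynomial.map_mul] at this
    change (quadPoly x).map φ * _ = (quadPoly x).map φ * _
    rw [this, map_quadPoly, map_quadPoly, hxy]
  obtain ⟨a, b, hab⟩ := hq.isCoprime
  obtain ⟨u, hu⟩ : IsUnit (a * quadPoly x + b * h') := by
    have : a * quadPoly x + b * h' = 1 + b * (h' - h) := by linear_combination hab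
    rw [this]
    exact (Commute.isNilpotent_mul_left (Commute.all _ _)
      (isNilpotent_of_map_eq_zero hφ hmap)).isUnit_one_add
  have hcop : IsCoprime (quadPoly x) h' := by
    refine ⟨↑u⁻¹ * a, ↑u⁻¹ * b, ?_⟩
    rw [mul_assoc, mul_assoc, ← mul_add, ← hu, Units.inv_mul]
  have hdvd : quadPoly x ∣ quadPoly y := hcop.dvd_of_dvd_mul_right (hh' ▸ dvd_mul_right _ _)
  apply quadPoly_injective
  exact (eq_of_monic_of_dvd_of_natDegree_le (monic_quadPoly x) (monic_quadPoly y) hdvd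
    (by rw [natDegree_quadPoly, natDegree_quadPoly])).symm

theorem separable_X_pow_sub_X_of_natCast_eq_zero {n : ℕ} (hn : (n : R) = 0) :
    (X ^ n - X : R[X]).Separable := by
  refine ⟨0, -1, ?_⟩
  simp [derivative_X_pow, hn]

end Hensel

/-! ### Reduction from prime powers to primes. -/

section PrimePowers

theorem isUnit_intCast_pow_iff {p r : ℕ} (hr : r ≠ 0) (z : ℤ) :
    IsUnit (z : ZMod (p ^ r)) ↔ IsUnit (z : ZMod p) := by
  rw [ZMod.coe_int_isUnit_iff_isCoprime, ZMod.coe_int_isUnit_iff_isCoprime, Nat.cast_pow,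
    IsCoprime.pow_left_iff (Nat.pos_of_ne_zero hr)]

/-- Since `p ^ r ∣ n`, the polynomial `X ^ n - X` is separable modulo `p` and modulo `p ^ r`.
Injectivity is uniqueness of lifts, the kernel of reduction being nilpotent; surjectivity is Hensel
lifting. -/
theorem bijOn_liarPair_pow {n p r : ℕ} (hr : r ≠ 0) (hpn : p ^ r ∣ n) :
    Set.BijOn (Prod.map (ZMod.castHom (dvd_pow_self p hr) (ZMod p))
        (ZMod.castHom (dvd_pow_self p hr) (ZMod p)))
      {x : ZMod (p ^ r) × ZMod (p ^ r) | IsLiarPair n x} {y : ZMod p × ZMod p | IsLiarPair n y} := by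
  have hsep : ∀ m : ℕ, m ∣ n → (X ^ n - X : (ZMod m)[X]).Separable := fun m hm =>
    separable_X_pow_sub_X_of_natCast_eq_zero ((ZMod.natCast_eq_zero_iff _ _).2 hm)
  have hmod : ∀ m : ℕ, reduceMod m (X ^ n - X) = X ^ n - X := by simp [reduceMod]
  have hquad : ∀ (m : ℕ) (b c : ℤ), reduceMod m (quadPoly (b, c)) =
      quadPoly ((b : ZMod m), (c : ZMod m)) := by
    intro m b c
    rw [reduceMod, map_quadPoly]
    rfl
  refine ⟨fun x hx => hx.map _, fun x hx y hy hxy => ?_, fun y hy => ?_⟩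
  · refine degree_two_divisor_unique (fun z hz => ?_) (hsep _ hpn) hx.2.2 hy.2.2 hxy
    obtain ⟨z, rfl⟩ := ZMod.intCast_surjective z
    rw [map_intCast, ZMod.intCast_zmod_eq_zero_iff_dvd] at hz
    refine ⟨r, ?_⟩
    rw [← Int.cast_pow, ZMod.intCast_zmod_eq_zero_iff_dvd, Nat.cast_pow]
    exact pow_dvd_pow_of_dvd hz r
  · obtain ⟨b, c, rfl⟩ := exists_intCast_pair y
    obtain ⟨hΔ, hc, h', hh'⟩ := hy
    obtain ⟨H₀, rfl⟩ := reduceMod_surjective p h'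
    have hdvd : C (p : ℤ) ∣ (X ^ n - X) - quadPoly (b, c) * H₀ := by
      rw [C_natCast_dvd_iff_reduceMod_eq_zero, reduceMod, Polynomial.map_sub, Polynomial.map_mul,
        ← reduceMod, ← reduceMod, ← reduceMod, hmod, hquad, hh', sub_self]
    obtain ⟨G, H, hG, hG2, hGG, hGH⟩ := exists_factor_lift
      (by rw [hmod]; exact hsep p ((dvd_pow_self p hr).trans hpn)) (monic_quadPoly _) hdvd (r - 1)
    rw [natDegree_quadPoly] at hG2
    obtain ⟨b', c', rfl⟩ : ∃ b' c' : ℤ, G = quadPoly (b', c') := ⟨_, _, eq_quadPoly_of_monic hG hG2⟩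
    rw [C_natCast_dvd_iff_reduceMod_eq_zero, reduceMod, Polynomial.map_sub, ← reduceMod,
      ← reduceMod, hquad, hquad, sub_eq_zero] at hGG
    have hbc := quadPoly_injective hGG
    rw [Nat.sub_add_cancel (Nat.one_le_iff_ne_zero.2 hr), ← C_pow, ← Nat.cast_pow,
      C_natCast_dvd_iff_reduceMod_eq_zero, reduceMod, Polynomial.map_sub, Polynomial.map_mul,
      ← reduceMod, ← reduceMod, ← reduceMod, hquad, hmod, sub_eq_zero] at hGH
    refine ⟨((b' : ZMod (p ^ r)), (c' : ZMod (p ^ r))), ⟨?_, ?_, _, hGH⟩, ?_⟩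
    · rw [← hbc] at hΔ
      have h : IsUnit ((b' ^ 2 - 4 * c' : ℤ) : ZMod p) := by push_cast; exact hΔ
      have := (isUnit_intCast_pow_iff hr _).2 h
      push_cast at this
      exact this
    · rw [← hbc] at hc
      exact (isUnit_intCast_pow_iff hr _).2 hc
    · simpa using hbc

theorem discrSymbol_pow {p r : ℕ} (hp : p ≠ 0) (hr : r ≠ 0) (x : ZMod (p ^ r) × ZMod (p ^ r)) :
    discrSymbol (p ^ r) x = discrSymbol p (Prod.map (ZMod.castHom (dvd_pow_self p hr) (ZMod p))
        (ZMod.castHom (dvd_pow_self p hr) (ZMod p)) x) ^ r := by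
  obtain ⟨b, c, rfl⟩ := exists_intCast_pair x
  rw [Prod.map_apply, map_intCast, map_intCast, discrSymbol_intCast, discrSymbol_intCast,
    kroneckerSymbol_pow_right _ hp]

open Classical in
theorem liarSum_prime_pow {n j p r : ℕ} [NeZero p] (hr : r ≠ 0) (hpn : p ^ r ∣ n) :
    liarSum n j (p ^ r) =
      ∑ x : ZMod p × ZMod p with IsLiarPair n x, discrSymbol p x ^ (r * j) := by
  have h := bijOn_liarPair_pow hr hpn
  rw [liarSum_eq_sum, ← Finset.sum_filter]
  refine Finset.sum_nbij (Prod.map (ZMod.castHom (dvd_pow_self p hr) (ZMod p))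
      (ZMod.castHom (dvd_pow_self p hr) (ZMod p)))
    (fun x hx => ?_) (fun x hx y hy => ?_) (fun y hy => ?_) (fun x _ => ?_)
  · simpa using h.mapsTo (by simpa using hx)
  · exact h.injOn (by simpa using hx) (by simpa using hy)
  · simpa using h.surjOn (by simpa using hy)
  · rw [discrSymbol_pow (NeZero.ne p) hr, pow_mul]

end PrimePowers

/-! ### Roots of unity in a finite field. -/

section FiniteFieldCounts

theorem card_filter_pow_eq_one {K : Type*} [Field K] [Fintype K] {m : ℕ} (hm : m ≠ 0)
    [DecidablePred fun a : K => a ^ m = 1] :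
    (Finset.univ.filter fun a : K => a ^ m = 1).card = Nat.gcd m (Fintype.card K - 1) := by
  have h := IsCyclic.card_powMonoidHom_ker (G := Kˣ) m
  rw [Nat.card_units, Nat.gcd_comm] at h
  classical
  rw [← Nat.card_eq_fintype_card (α := K), ← h, Nat.card_eq_fintype_card, ← Finset.card_univ]
  symm
  refine Finset.card_bij (fun u _ => ((u : Kˣ) : K)) (fun u _ => ?_) (fun u _ v _ huv => ?_)
    fun a ha => ?_
  · have hu : (u : Kˣ) ^ m = 1 := u.2
    simpa using congrArg Units.val hu
  · exact Subtype.ext (Units.ext huv)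
  · have ha1 : a ^ m = 1 := by simpa using ha
    have ha0 : a ≠ 0 := by
      rintro rfl
      rw [zero_pow hm] at ha1
      exact zero_ne_one ha1
    refine ⟨⟨Units.mk0 a ha0, ?_⟩, Finset.mem_univ _, rfl⟩
    rw [MonoidHom.mem_ker, powMonoidHom_apply]
    ext
    simpa using ha1

end FiniteFieldCounts

/-! ### Quadratic divisors over the prime field, split and irreducible. -/

section PrimeModulus

theorem kroneckerSymbol_two_right (a : ℤ) : kroneckerSymbol a 2 = ZMod.χ₈ (a : ZMod 8) := by
  simp [kroneckerSymbol]

theorem discrSymbol_two (x : ZMod 2 × ZMod 2) :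
    discrSymbol 2 x = ZMod.χ₈ ((x.1.cast : ZMod 8) ^ 2 - 4 * (x.2.cast : ZMod 8)) := by
  rw [discrSymbol, kroneckerSymbol_two_right]
  push_cast
  rfl

theorem discrSymbol_two_eq_zero_iff (x : ZMod 2 × ZMod 2) :
    discrSymbol 2 x = 0 ↔ x.1 ^ 2 - 4 * x.2 = 0 := by
  rw [discrSymbol_two]
  revert x
  decide

theorem discrSymbol_two_eq_one_or_neg_one {x : ZMod 2 × ZMod 2} (hx : x.1 ^ 2 - 4 * x.2 ≠ 0) :
    discrSymbol 2 x = 1 ∨ discrSymbol 2 x = -1 := by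
  rw [discrSymbol_two]
  revert x
  decide

/-- The Kronecker convention at 2 is what makes this work: `X ^ 2 + X` has discriminant 1, while `X
^ 2 + X + 1` has discriminant -3. Hence 2 needs no separate treatment in the counts. -/
theorem discrSymbol_two_eq_neg_one_iff (x : ZMod 2 × ZMod 2) :
    discrSymbol 2 x = -1 ↔ ∀ t : ZMod 2, t ^ 2 + x.1 * t + x.2 ≠ 0 := by
  rw [discrSymbol_two]
  revert x
  decide

variable {p : ℕ} [hp : Fact p.Prime]

theorem discrSymbol_eq_quadraticChar (h2 : p ≠ 2) (x : ZMod p × ZMod p) :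
    discrSymbol p x = quadraticChar (ZMod p) (x.1 ^ 2 - 4 * x.2) := by
  obtain ⟨b, c, rfl⟩ := exists_intCast_pair x
  rw [discrSymbol_intCast, kroneckerSymbol_of_odd _ (hp.out.odd_of_ne_two h2),
    ← jacobiSym.legendreSym.to_jacobiSym, legendreSym]
  push_cast
  rfl

theorem discrSymbol_eq_zero_iff (x : ZMod p × ZMod p) :
    discrSymbol p x = 0 ↔ x.1 ^ 2 - 4 * x.2 = 0 := by
  rcases eq_or_ne p 2 with rfl | h2
  · exact discrSymbol_two_eq_zero_iff x
  · rw [discrSymbol_eq_quadraticChar h2, quadraticChar_eq_zero_iff]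

theorem discrSymbol_eq_one_or_neg_one {x : ZMod p × ZMod p} (hx : x.1 ^ 2 - 4 * x.2 ≠ 0) :
    discrSymbol p x = 1 ∨ discrSymbol p x = -1 := by
  rcases eq_or_ne p 2 with rfl | h2
  · exact discrSymbol_two_eq_one_or_neg_one hx
  · rw [discrSymbol_eq_quadraticChar h2]
    exact quadraticChar_dichotomy hx

theorem discrSymbol_eq_neg_one_iff (x : ZMod p × ZMod p) :
    discrSymbol p x = -1 ↔ ∀ t : ZMod p, t ^ 2 + x.1 * t + x.2 ≠ 0 := by
  rcases eq_or_ne p 2 with rfl | h2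
  · exact discrSymbol_two_eq_neg_one_iff x
  · have h2' : (2 : ZMod p) ≠ 0 := by
      intro h
      have h' : ((2 : ℕ) : ZMod p) = 0 := by exact_mod_cast h
      rw [ZMod.natCast_eq_zero_iff] at h'
      exact h2 ((Nat.prime_dvd_prime_iff_eq hp.out Nat.prime_two).1 h')
    rw [discrSymbol_eq_quadraticChar h2, quadraticChar_neg_one_iff_not_isSquare, ← not_exists_not,
      not_iff_not]
    simp only [not_not]
    constructor
    · rintro ⟨s, hs⟩
      refine ⟨(s - x.1) / 2, ?_⟩
      field_simp
      linear_combination -hs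
    · rintro ⟨t, ht⟩
      exact ⟨2 * t + x.1, by linear_combination -4 * ht⟩

theorem discrSymbol_eq_one_of_root {x : ZMod p × ZMod p} (hx : x.1 ^ 2 - 4 * x.2 ≠ 0)
    {t : ZMod p} (ht : t ^ 2 + x.1 * t + x.2 = 0) : discrSymbol p x = 1 :=
  (discrSymbol_eq_one_or_neg_one hx).resolve_right fun h =>
    (discrSymbol_eq_neg_one_iff x).1 h t ht

theorem quadPoly_of_roots {R : Type*} [CommRing R] (s t : R) :
    quadPoly (-(s + t), s * t) = (X - C s) * (X - C t) := by
  simp only [quadPoly, map_neg, map_add, map_mul]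
  ring

-- Ordered pairs of distinct roots of unity `a ^ (n - 1) = 1` map to the coefficients of `(X - a) *
-- (X - b)`; each fibre consists of the two orderings of the roots.
open Classical in
theorem two_mul_card_liarPair_split {n : ℕ} (hn : 1 < n) :
    2 * (Finset.univ.filter fun x : ZMod p × ZMod p =>
      IsLiarPair n x ∧ discrSymbol p x = 1).card =
      Nat.gcd (n - 1) (p - 1) * Nat.gcd (n - 1) (p - 1) - Nat.gcd (n - 1) (p - 1) := by
  set U := Finset.univ.filter fun a : ZMod p => a ^ (n - 1) = 1 with hU
  have hUcard : U.card = Nat.gcd (n - 1) (p - 1) := by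
    rw [hU, card_filter_pow_eq_one (by omega), ZMod.card]
  have hUmem : ∀ a, a ∈ U ↔ a ≠ 0 ∧ a ^ n = a := by
    intro a
    rw [hU, Finset.mem_filter, and_iff_right (Finset.mem_univ a)]
    have hpow : a ^ n = a ^ (n - 1) * a := by rw [← pow_succ, Nat.sub_add_cancel hn.le]
    constructor
    · intro h
      refine ⟨?_, by rw [hpow, h, one_mul]⟩
      rintro rfl
      rw [zero_pow (by omega)] at h
      exact zero_ne_one h
    · rintro ⟨h0, h⟩
      exact mul_right_cancel₀ h0 (by rw [← hpow, h, one_mul])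
  rw [← hUcard, ← Finset.offDiag_card, mul_comm]
  refine ((Finset.card_eq_sum_card_fiberwise
    (f := fun y : ZMod p × ZMod p => (-(y.1 + y.2), y.1 * y.2)) ?_).trans
      (Finset.sum_const_nat ?_)).symm
  swap
  · intro x hx
    obtain ⟨⟨hΔ, hc, hdvd⟩, hκ⟩ := (Finset.mem_filter.1 hx).2
    obtain ⟨t, ht⟩ : ∃ t : ZMod p, t ^ 2 + x.1 * t + x.2 = 0 := by
      by_contra! h
      rw [(discrSymbol_eq_neg_one_iff x).2 h] at hκ
      norm_num at hκ
    obtain ⟨t', ht'⟩ : ∃ t', t' = -x.1 - t := ⟨_, rfl⟩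
    have hx1 : x.1 = -(t + t') := by rw [ht']; ring
    have hx2 : x.2 = t * t' := by rw [ht']; linear_combination ht
    have hroot : ∀ s : ZMod p, s ^ 2 + x.1 * s + x.2 = 0 → s ∈ U := by
      intro s hs
      rw [hUmem]
      constructor
      · rintro rfl
        apply hc.ne_zero
        linear_combination hs
      · obtain ⟨q, hq⟩ := hdvd
        have := congrArg (eval s) hq
        rw [eval_mul, eval_quadPoly, hs, zero_mul] at this
        simpa [sub_eq_zero] using this
    have hne : t ≠ t' := by
      rintro rfl
      apply hΔ.ne_zero
      rw [hx1, hx2]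
      ring
    rw [Finset.card_eq_two]
    refine ⟨(t, t'), (t', t), fun h => hne (congrArg Prod.fst h), ?_⟩
    ext ⟨a, b⟩
    simp only [Finset.mem_filter, Finset.mem_offDiag, Finset.mem_insert, Finset.mem_singleton,
      Prod.mk.injEq]
    constructor
    · rintro ⟨-, h⟩
      have h1 : -(a + b) = -(t + t') := (congrArg Prod.fst h).trans hx1
      have h2 : a * b = t * t' := (congrArg Prod.snd h).trans hx2
      -- Equal sum and product make `a` a root of `(X - t) * (X - t')`.
      have h3 : (a - t) * (a - t') = 0 := by linear_combination (-a) * h1 - h2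
      rcases mul_eq_zero.1 h3 with h | h
      · have : a = t := by linear_combination h
        exact Or.inl ⟨this, by linear_combination -h1 - this⟩
      · have : a = t' := by linear_combination h
        exact Or.inr ⟨this, by linear_combination -h1 - this⟩
    · have ht1 := hroot t ht
      have ht2 := hroot t' (by rw [hx1, hx2]; ring)
      rintro (⟨rfl, rfl⟩ | ⟨rfl, rfl⟩)
      · exact ⟨⟨ht1, ht2, hne⟩, Prod.ext hx1.symm hx2.symm⟩
      · exact ⟨⟨ht2, ht1, hne.symm⟩, Prod.ext (by rw [hx1]; ring) (by rw [hx2]; ring)⟩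
  · rintro ⟨a, b⟩ hab
    rw [Finset.mem_coe, Finset.mem_offDiag, hUmem, hUmem] at hab
    obtain ⟨⟨ha0, ha⟩, ⟨hb0, hb⟩, hne⟩ := hab
    dsimp only at ha0 ha hb0 hb hne
    have hΔ : (-(a + b)) ^ 2 - 4 * (a * b) ≠ 0 := by
      have : (-(a + b)) ^ 2 - 4 * (a * b) = (a - b) ^ 2 := by ring
      rw [this]
      exact pow_ne_zero 2 (sub_ne_zero.2 hne)
    rw [Finset.mem_coe, Finset.mem_filter]
    refine ⟨Finset.mem_univ _, ⟨hΔ.isUnit, (mul_ne_zero ha0 hb0).isUnit, ?_⟩,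
      discrSymbol_eq_one_of_root hΔ (t := a) (by ring)⟩
    rw [quadPoly_of_roots]
    refine IsCoprime.mul_dvd (isCoprime_X_sub_C_of_isUnit_sub (sub_ne_zero.2 hne).isUnit) ?_ ?_
    · rw [dvd_iff_isRoot]
      simp [ha]
    · rw [dvd_iff_isRoot]
      simp [hb]

theorem irreducible_quadPoly {x : ZMod p × ZMod p} (hx : discrSymbol p x = -1) :
    Irreducible (quadPoly x) := by
  rw [discrSymbol_eq_neg_one_iff] at hx
  rw [(monic_quadPoly x).irreducible_iff_roots_eq_zero_of_degree_le_three
    (by rw [natDegree_quadPoly]) (by rw [natDegree_quadPoly]; norm_num)]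
  refine Multiset.eq_zero_of_forall_notMem fun t ht => hx t ?_
  rw [← eval_quadPoly]
  exact (mem_roots'.1 ht).2

theorem aeval_quadPoly {F K : Type*} [CommRing F] [CommRing K] [Algebra F K] (x : F × F) (a : K) :
    aeval a (quadPoly x) = a ^ 2 + algebraMap F K x.1 * a + algebraMap F K x.2 := by
  simp [quadPoly]

/-- Adjoining a root gives a quadratic extension of the prime field, which embeds into any other
one. -/
theorem exists_root_of_finrank_eq_two {K : Type*} [Field K] [Finite K] [Algebra (ZMod p) K]
    (hK : Module.finrank (ZMod p) K = 2) {x : ZMod p × ZMod p} (hx : discrSymbol p x = -1) :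
    ∃ a : K, aeval a (quadPoly x) = 0 := by
  have : Fact (Irreducible (quadPoly x)) := ⟨irreducible_quadPoly hx⟩
  have hfin : Module.finrank (ZMod p) (AdjoinRoot (quadPoly x)) = 2 := by
    rw [(AdjoinRoot.powerBasis (monic_quadPoly x).ne_zero).finrank, AdjoinRoot.powerBasis_dim,
      natDegree_quadPoly]
  have : Finite (AdjoinRoot (quadPoly x)) :=
    have : Module.Finite (ZMod p) (AdjoinRoot (quadPoly x)) :=
      Module.finite_of_finrank_pos (by rw [hfin]; norm_num)
    Module.finite_of_finite (ZMod p)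
  obtain ⟨φ⟩ := FiniteField.nonempty_algHom_of_finrank_dvd (F := ZMod p)
    (K := AdjoinRoot (quadPoly x)) (L := K) (by rw [hfin, hK])
  refine ⟨φ (AdjoinRoot.root _), ?_⟩
  rw [aeval_algHom_apply, AdjoinRoot.aeval_eq, AdjoinRoot.mk_self, map_zero]

theorem natDegree_minpoly_eq_two {F K : Type*} [Field F] [Field K] [Algebra F K]
    (hK : Module.finrank F K = 2) {a : K} (ha : a ∉ (algebraMap F K).range) :
    (minpoly F a).natDegree = 2 := by
  have : FiniteDimensional F K := Module.finite_of_finrank_pos (by rw [hK]; norm_num)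
  have hint : IsIntegral F a := Algebra.IsIntegral.isIntegral a
  have h1 := minpoly.natDegree_le (A := F) a
  have h2 := minpoly.natDegree_pos hint
  have h3 : (minpoly F a).natDegree ≠ 1 := fun h => ha (minpoly.natDegree_eq_one_iff.1 h)
  omega

-- Sending `a` to its minimal polynomial maps the solutions of `a ^ (n - 1) = 1` in the quadratic
-- extension, outside the prime field, onto the irreducible liar pairs. Each fibre is a pair of
-- distinct conjugates.
open Classical in
theorem two_mul_card_liarPair_inert {n : ℕ} (hn : 1 < n) :
    2 * (Finset.univ.filter fun x : ZMod p × ZMod p =>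
      IsLiarPair n x ∧ discrSymbol p x = -1).card =
      Nat.gcd (n - 1) (p ^ 2 - 1) - Nat.gcd (n - 1) (p - 1) := by
  set K := GaloisField p 2
  have hK : Module.finrank (ZMod p) K = 2 := GaloisField.finrank p two_ne_zero
  have : Fintype K := Fintype.ofFinite K
  have hcard : Fintype.card K = p ^ 2 := by
    rw [← Nat.card_eq_fintype_card, GaloisField.card p 2 two_ne_zero]
  set W := Finset.univ.filter fun a : K => a ^ (n - 1) = 1 with hW
  set U := Finset.univ.filter fun a : ZMod p => a ^ (n - 1) = 1 with hU
  have hinj := (algebraMap (ZMod p) K).injective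
  have hVcard : (W \ U.image (algebraMap (ZMod p) K)).card =
      Nat.gcd (n - 1) (p ^ 2 - 1) - Nat.gcd (n - 1) (p - 1) := by
    rw [Finset.card_sdiff_of_subset, Finset.card_image_of_injective _ hinj, hW, hU,
      card_filter_pow_eq_one (by omega), card_filter_pow_eq_one (by omega), hcard, ZMod.card]
    intro a ha
    obtain ⟨u, hu, rfl⟩ := Finset.mem_image.1 ha
    rw [hU, Finset.mem_filter] at hu
    rw [hW, Finset.mem_filter, ← map_pow, hu.2, map_one]
    exact ⟨Finset.mem_univ _, rfl⟩
  have hVmem : ∀ a, a ∈ W \ U.image (algebraMap (ZMod p) K) ↔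
      a ^ n = a ∧ a ∉ (algebraMap (ZMod p) K).range := by
    intro a
    have hpow : a ^ n = a ^ (n - 1) * a := by rw [← pow_succ, Nat.sub_add_cancel hn.le]
    rw [Finset.mem_sdiff, hW, Finset.mem_filter, and_iff_right (Finset.mem_univ a)]
    constructor
    · rintro ⟨h1, h2⟩
      refine ⟨by rw [hpow, h1, one_mul], ?_⟩
      rintro ⟨u, rfl⟩
      refine h2 (Finset.mem_image_of_mem _ ?_)
      rw [hU, Finset.mem_filter]
      exact ⟨Finset.mem_univ _, hinj (by rw [map_pow, h1, map_one])⟩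
    · rintro ⟨h1, h2⟩
      have h0 : a ≠ 0 := by
        rintro rfl
        exact h2 (zero_mem _)
      refine ⟨mul_right_cancel₀ h0 (by rw [← hpow, h1, one_mul]), fun h => h2 ?_⟩
      obtain ⟨u, -, rfl⟩ := Finset.mem_image.1 h
      exact ⟨u, rfl⟩
  have hmin : ∀ a : K, a ∉ (algebraMap (ZMod p) K).range →
      minpoly (ZMod p) a = quadPoly ((minpoly (ZMod p) a).coeff 1, (minpoly (ZMod p) a).coeff 0) :=
    fun a ha => eq_quadPoly_of_monic (minpoly.monic (Algebra.IsIntegral.isIntegral a))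
      (natDegree_minpoly_eq_two hK ha)
  rw [← hVcard, mul_comm]
  refine ((Finset.card_eq_sum_card_fiberwise
    (f := fun a : K => ((minpoly (ZMod p) a).coeff 1, (minpoly (ZMod p) a).coeff 0)) ?_).trans
      (Finset.sum_const_nat ?_)).symm
  swap
  · intro x hx
    obtain ⟨⟨hΔ, hc, hdvd⟩, hκ⟩ := (Finset.mem_filter.1 hx).2
    obtain ⟨t, ht⟩ := exists_root_of_finrank_eq_two hK hκ
    have htx := ht
    rw [aeval_quadPoly] at ht
    -- The conjugate root, read off from the sum of the roots.
    obtain ⟨t', ht'⟩ : ∃ t', t' = -algebraMap (ZMod p) K x.1 - t := ⟨_, rfl⟩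
    have hx1 : algebraMap (ZMod p) K x.1 = -(t + t') := by rw [ht']; ring
    have hx2 : algebraMap (ZMod p) K x.2 = t * t' := by rw [ht']; linear_combination ht
    have hne : t ≠ t' := by
      rintro rfl
      apply hΔ.ne_zero
      apply hinj
      rw [map_sub, map_pow, map_mul, hx1, hx2, map_zero, map_ofNat]
      ring
    rw [Finset.card_eq_two]
    refine ⟨t, t', hne, ?_⟩
    ext a
    rw [Finset.mem_filter, hVmem, Finset.mem_insert, Finset.mem_singleton]
    constructor
    · rintro ⟨⟨-, hr⟩, hax⟩
      have h0 := minpoly.aeval (ZMod p) a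
      rw [hmin a hr, hax, aeval_quadPoly, hx1, hx2] at h0
      have h3 : (a - t) * (a - t') = 0 := by linear_combination h0
      rcases mul_eq_zero.1 h3 with h | h
      · exact Or.inl (by linear_combination h)
      · exact Or.inr (by linear_combination h)
    · intro h
      have ha : aeval a (quadPoly x) = 0 := by
        rw [aeval_quadPoly, hx1, hx2]
        rcases h with rfl | rfl <;> ring
      have hmina : quadPoly x = minpoly (ZMod p) a :=
        minpoly.eq_of_irreducible_of_monic (irreducible_quadPoly hκ) ha (monic_quadPoly x)
      refine ⟨⟨?_, ?_⟩, ?_⟩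
      · obtain ⟨q, hq⟩ := hdvd
        have := congrArg (aeval a) hq
        rw [map_mul, ha, zero_mul] at this
        simpa [sub_eq_zero] using this
      · rintro ⟨u, rfl⟩
        refine (discrSymbol_eq_neg_one_iff x).1 hκ u (hinj ?_)
        rw [aeval_quadPoly] at ha
        simpa using ha
      · rw [← hmina, quadPoly_coeff_one, quadPoly_coeff_zero]
  · intro a ha
    rw [Finset.mem_coe, hVmem] at ha
    obtain ⟨han, har⟩ := ha
    have hint : IsIntegral (ZMod p) a := Algebra.IsIntegral.isIntegral a
    have h := hmin a har
    set x : ZMod p × ZMod p := ((minpoly (ZMod p) a).coeff 1, (minpoly (ZMod p) a).coeff 0)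
    have hirr : Irreducible (quadPoly x) := h ▸ minpoly.irreducible hint
    have hκ : discrSymbol p x = -1 := by
      rw [discrSymbol_eq_neg_one_iff]
      intro t ht
      refine hirr.not_isRoot_of_natDegree_ne_one (by rw [natDegree_quadPoly]; norm_num) (x := t) ?_
      rw [IsRoot, eval_quadPoly, ht]
    rw [Finset.mem_coe, Finset.mem_filter]
    refine ⟨Finset.mem_univ _, ⟨?_, ?_, ?_⟩, hκ⟩
    · refine IsUnit.mk0 _ fun h0 => ?_
      rw [← discrSymbol_eq_zero_iff, hκ] at h0
      norm_num at h0
    · refine IsUnit.mk0 _ (minpoly.coeff_zero_ne_zero hint ?_)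
      rintro rfl
      exact har (zero_mem _)
    · rw [← h]
      exact minpoly.dvd _ _ (by simp [han])

end PrimeModulus

/-! ### Assembling the local and global counts. -/

section Counting

theorem isUnit_kroneckerSymbol {a : ℤ} {m : ℕ} (h : IsCoprime (m : ℤ) a) :
    IsUnit (kroneckerSymbol a m) := by
  have hd : (m / 2 ^ padicValNat 2 m) ∣ m := Nat.div_dvd_of_dvd pow_padicValNat_dvd
  refine IsUnit.mul ?_ ?_
  · by_cases h2 : 2 ∣ m
    · refine (IsUnit.map ZMod.χ₈ ?_).pow _
      have h2' : ((2 : ℕ) : ℤ) ∣ m := Int.natCast_dvd_natCast.2 h2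
      rw [show (8 : ℕ) = 2 ^ 3 by norm_num, isUnit_intCast_pow_iff three_ne_zero,
        ZMod.coe_int_isUnit_iff_isCoprime]
      exact h.of_isCoprime_of_dvd_left h2'
    · rw [padicValNat.eq_zero_of_not_dvd h2, pow_zero]
      exact isUnit_one
  · have hc : IsCoprime a ((m / 2 ^ padicValNat 2 m : ℕ) : ℤ) :=
      (h.of_isCoprime_of_dvd_left (Int.natCast_dvd_natCast.2 hd)).symm
    rw [Int.isUnit_iff]
    exact jacobiSym.eq_one_or_neg_one (Int.isCoprime_iff_gcd_eq_one.1 hc)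

theorem IsLiarPair.discrSymbol_eq_one_or_neg_one {n m : ℕ} {x : ZMod m × ZMod m}
    (h : IsLiarPair n x) : discrSymbol m x = 1 ∨ discrSymbol m x = -1 := by
  obtain ⟨b, c, rfl⟩ := exists_intCast_pair x
  rw [discrSymbol_intCast, ← Int.isUnit_iff]
  apply isUnit_kroneckerSymbol
  rw [← ZMod.coe_int_isUnit_iff_isCoprime]
  push_cast
  exact h.1

open Classical in
theorem sum_discrSymbol_pow {n m : ℕ} [NeZero m] (k : ℕ) :
    ∑ x : ZMod m × ZMod m with IsLiarPair n x, discrSymbol m x ^ k =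
      ((Finset.univ.filter fun x : ZMod m × ZMod m =>
          IsLiarPair n x ∧ discrSymbol m x = 1).card : ℤ) +
        (-1) ^ k * ((Finset.univ.filter fun x : ZMod m × ZMod m =>
          IsLiarPair n x ∧ discrSymbol m x = -1).card : ℤ) := by
  rw [← Finset.filter_filter, ← Finset.filter_filter, Finset.card_filter, Finset.card_filter]
  push_cast
  rw [Finset.mul_sum, ← Finset.sum_add_distrib]
  refine Finset.sum_congr rfl fun x hx => ?_
  rcases (Finset.mem_filter.1 hx).2.discrSymbol_eq_one_or_neg_one with h | h <;> rw [h] <;> norm_num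

-- On liar pairs the symbol is a sign `ε`, and `1 + ε` is 2 or 0.
open Classical in
theorem two_mul_card_discrSymbol_eq_one (n m : ℕ) [NeZero m] :
    2 * ((Finset.univ.filter fun x : ZMod m × ZMod m =>
      IsLiarPair n x ∧ discrSymbol m x = 1).card : ℤ) = liarSum n 0 m + liarSum n 1 m := by
  rw [liarSum_eq_sum, liarSum_eq_sum, ← Finset.sum_filter, ← Finset.sum_filter,
    sum_discrSymbol_pow, sum_discrSymbol_pow]
  ring

variable {n p : ℕ}

open Classical in
theorem card_liarPair_split [Fact p.Prime] (hn : 1 < n) :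
    ((Finset.univ.filter fun x : ZMod p × ZMod p =>
      IsLiarPair n x ∧ discrSymbol p x = 1).card : ℚ) = liarCountPlusPlus n p := by
  have h := two_mul_card_liarPair_split (p := p) hn
  have hd : 0 < Nat.gcd (n - 1) (p - 1) := Nat.gcd_pos_of_pos_left _ (by omega)
  have h' := congrArg (Nat.cast : ℕ → ℚ) h
  rw [Nat.cast_sub (Nat.le_mul_of_pos_left _ hd)] at h'
  push_cast at h'
  rw [liarCountPlusPlus]
  linear_combination h' / 2

open Classical in
theorem card_liarPair_inert [Fact p.Prime] (hn : 1 < n) :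
    ((Finset.univ.filter fun x : ZMod p × ZMod p =>
      IsLiarPair n x ∧ discrSymbol p x = -1).card : ℚ) = liarCountPlusMinus n p := by
  have h := two_mul_card_liarPair_inert (p := p) hn
  -- The natural-number subtraction in `h` is not truncated, because `p - 1 ∣ p ^ 2 - 1`.
  have hdvd : Nat.gcd (n - 1) (p - 1) ≤ Nat.gcd (n - 1) (p ^ 2 - 1) :=
    Nat.le_of_dvd (Nat.gcd_pos_of_pos_left _ (by omega))
      (Nat.gcd_dvd_gcd_of_dvd_right _ (by simpa using Nat.sub_dvd_pow_sub_pow p 1 2))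
  have h' := congrArg (Nat.cast : ℕ → ℚ) h
  rw [Nat.cast_sub hdvd] at h'
  push_cast at h'
  rw [liarCountPlusMinus]
  linear_combination h' / 2

theorem liarSum_prime_pow_eq [Fact p.Prime] (hn : 1 < n) {r : ℕ} (hr : r ≠ 0) (hpn : p ^ r ∣ n)
    (j : ℕ) : (liarSum n j (p ^ r) : ℚ) =
      liarCountPlusPlus n p + (-1) ^ (r * j) * liarCountPlusMinus n p := by
  classical
  have : NeZero p := ⟨(Fact.out : p.Prime).ne_zero⟩
  rw [liarSum_prime_pow hr hpn, sum_discrSymbol_pow, ← card_liarPair_split hn,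
    ← card_liarPair_inert hn]
  push_cast
  rfl

theorem eq_reduceMod_quadPoly {f : ℤ[X]} (hf : f.Monic) (h2 : f.natDegree = 2) (m : ℕ) :
    reduceMod m f = quadPoly (((f.coeff 1 : ℤ) : ZMod m), ((f.coeff 0 : ℤ) : ZMod m)) := by
  conv_lhs => rw [eq_quadPoly_of_monic hf h2]
  rw [reduceMod, map_quadPoly]
  rfl

theorem isGCMD_self_iff {R : Type*} [CommRing R] {g h : R[X]} (hh : h.Monic) :
    IsGCMD g h h ↔ h ∣ g := by
  rw [IsGCMD, and_iff_right hh, Ideal.span_pair_comm]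
  constructor
  · intro H
    rw [← Ideal.mem_span_singleton, ← H]
    exact Ideal.subset_span (by simp)
  · intro H
    apply le_antisymm
    · rw [Ideal.span_le]
      rintro x (rfl | rfl)
      · exact Ideal.mem_span_singleton_self _
      · exact Ideal.mem_span_singleton.2 H
    · exact Ideal.span_mono (by simp)

theorem frobeniusLiarsPlus_eq_image (hn : 1 < n) (hcomp : ¬ n.Prime) :
    frobeniusLiarsPlus n =
      quadPoly '' {x : ZMod n × ZMod n | IsLiarPair n x ∧ discrSymbol n x = 1} := by
  have : Fact (1 < n) := ⟨hn⟩
  have hgcd : ∀ b c : ℤ, Int.gcd (n : ℤ) (c * (b ^ 2 - 4 * c)) = 1 ↔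
      IsUnit ((b : ZMod n) ^ 2 - 4 * (c : ZMod n)) ∧ IsUnit (c : ZMod n) := by
    intro b c
    rw [← Int.isCoprime_iff_gcd_eq_one, ← ZMod.coe_int_isUnit_iff_isCoprime]
    push_cast
    rw [IsUnit.mul_iff, and_comm]
  ext g
  constructor
  · rintro ⟨f, ⟨-, -, hf, h2, hg, F₁, f₁, F₂, f₂, ⟨h1, hF, hF₂, hf₁, rfl⟩, -, S, hS, hsgn⟩, hκ, rfl⟩
    rw [discr_eq_of_monic hf h2] at hg hκ hsgn
    rw [← coeff_zero_eq_eval_zero, hgcd] at hg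
    rw [mul_one] at hf₁
    subst hf₁
    have hred := eq_reduceMod_quadPoly hf h2 n
    refine ⟨_, ⟨⟨hg.1, hg.2, ?_⟩, ?_⟩, hred.symm⟩
    -- The degrees of `F₁` and `F₂` add up to 2, so `S ≤ 1`; the sign excludes `S = 1`, leaving `F₂
    -- = 1` and `F₁ = f`.
    · have hdeg := congrArg natDegree hF
      rw [h1.1.natDegree_mul hF₂.1, hred, natDegree_quadPoly, hS] at hdeg
      have hS0 : S = 0 := by
        have : S ≠ 1 := by
          rintro rfl
          rw [hκ] at hsgn
          norm_num at hsgn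
        omega
      have hF₂one : f₁ = 1 := eq_one_of_monic_natDegree_zero hF₂.1 (by rw [hS, hS0])
      rw [hF₂one, mul_one, hred] at hF
      rw [hred, ← hF, isGCMD_self_iff (monic_quadPoly _)] at h1
      exact h1
    · rw [discrSymbol_intCast, hκ]
  · rintro ⟨x, ⟨⟨hΔ, hc, hdvd⟩, hκ⟩, rfl⟩
    obtain ⟨b, c, rfl⟩ := exists_intCast_pair x
    rw [discrSymbol_intCast] at hκ
    have hmon := monic_quadPoly (b, c)
    have hdeg := natDegree_quadPoly (b, c)
    have hred := eq_reduceMod_quadPoly hmon hdeg n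
    have hdisc := discr_eq_of_monic hmon hdeg
    rw [quadPoly_coeff_one, quadPoly_coeff_zero] at hred hdisc
    refine ⟨quadPoly (b, c), ⟨hn, hcomp, hmon, hdeg, ?_, ?_⟩, ?_, hred⟩
    · rw [hdisc, ← coeff_zero_eq_eval_zero, quadPoly_coeff_zero, hgcd]
      exact ⟨hΔ, hc⟩
    -- All of `f` is absorbed by `F₁`; with `F₂ = 1` the Frobenius step is trivial and `S = 0`.
    · refine ⟨reduceMod n (quadPoly (b, c)), 1, 1, 1, ⟨?_, by simp, ?_, by simp, rfl⟩,
        one_dvd _, 0, by simp, ?_⟩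
      · rw [hred, isGCMD_self_iff (monic_quadPoly _)]
        exact hdvd
      · exact (isGCMD_self_iff monic_one).2 (one_dvd _)
      · rw [hdisc, hκ, pow_zero]
    · rw [hdisc, hκ]

theorem frobeniusLiarsPlus_finite (hn : 1 < n) (hcomp : ¬ n.Prime) :
    (frobeniusLiarsPlus n).Finite := by
  have : NeZero n := ⟨by omega⟩
  rw [frobeniusLiarsPlus_eq_image hn hcomp]
  exact (Set.toFinite _).image _

theorem two_mul_ncard_frobeniusLiarsPlus (hn : 1 < n) (hcomp : ¬ n.Prime) :
    2 * ((frobeniusLiarsPlus n).ncard : ℤ) = liarSum n 0 n + liarSum n 1 n := by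
  classical
  have : NeZero n := ⟨by omega⟩
  rw [← two_mul_card_discrSymbol_eq_one, frobeniusLiarsPlus_eq_image hn hcomp,
    Set.ncard_image_of_injective _ quadPoly_injective, ← Set.ncard_coe_finset]
  simp

theorem localFrobeniusLiarsPlus_eq_image [Fact p.Prime] {r : ℕ} (hr : r ≠ 0) (ε : ℤ) :
    localFrobeniusLiarsPlus n p r ε = quadPoly '' {x : ZMod (p ^ r) × ZMod (p ^ r) |
      IsLiarPair n x ∧ discrSymbol p (Prod.map (ZMod.castHom (dvd_pow_self p hr) (ZMod p))
        (ZMod.castHom (dvd_pow_self p hr) (ZMod p)) x) = ε} := by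
  have hunit : ∀ z : ℤ, ¬ (p : ℤ) ∣ z ↔ IsUnit (z : ZMod (p ^ r)) := by
    intro z
    rw [isUnit_intCast_pow_iff hr, isUnit_iff_ne_zero, Ne, ZMod.intCast_zmod_eq_zero_iff_dvd]
  ext g
  constructor
  · rintro ⟨f, hf, h2, hΔ, hc, hκ, hg, rfl⟩
    have hred := eq_reduceMod_quadPoly hf h2 (p ^ r)
    rw [discr_eq_of_monic hf h2] at hΔ hκ
    rw [← coeff_zero_eq_eval_zero, hunit] at hc
    rw [hunit] at hΔ
    push_cast at hΔ
    rw [hred, isGCMD_self_iff (monic_quadPoly _)] at hg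
    refine ⟨_, ⟨⟨hΔ, hc, hg⟩, ?_⟩, hred.symm⟩
    rw [Prod.map_apply, map_intCast, map_intCast, discrSymbol_intCast, hκ]
  · rintro ⟨x, ⟨⟨hΔ, hc, hdvd⟩, hκ⟩, rfl⟩
    obtain ⟨b, c, rfl⟩ := exists_intCast_pair x
    rw [Prod.map_apply, map_intCast, map_intCast, discrSymbol_intCast] at hκ
    have hmon := monic_quadPoly (b, c)
    have hdeg := natDegree_quadPoly (b, c)
    have hred := eq_reduceMod_quadPoly hmon hdeg (p ^ r)
    have hdisc := discr_eq_of_monic hmon hdeg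
    rw [quadPoly_coeff_one, quadPoly_coeff_zero] at hred hdisc
    refine ⟨quadPoly (b, c), hmon, hdeg, ?_, ?_, ?_, ?_, hred⟩
    · rw [hdisc, hunit]
      push_cast
      exact hΔ
    · rw [← coeff_zero_eq_eval_zero, quadPoly_coeff_zero, hunit]
      exact hc
    · rw [hdisc, hκ]
    · rw [hred, isGCMD_self_iff (monic_quadPoly _)]
      exact hdvd

theorem localFrobeniusLiarsPlus_finite [Fact p.Prime] {r : ℕ} (hr : r ≠ 0) (ε : ℤ) :
    (localFrobeniusLiarsPlus n p r ε).Finite := by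
  have : NeZero p := ⟨(Fact.out : p.Prime).ne_zero⟩
  rw [localFrobeniusLiarsPlus_eq_image hr]
  exact (Set.toFinite _).image _

open Classical in
theorem ncard_localFrobeniusLiarsPlus [Fact p.Prime] {r : ℕ} (hr : r ≠ 0) (hpn : p ^ r ∣ n)
    (ε : ℤ) : (localFrobeniusLiarsPlus n p r ε).ncard =
      (Finset.univ.filter fun x : ZMod p × ZMod p =>
        IsLiarPair n x ∧ discrSymbol p x = ε).card := by
  have hbij := bijOn_liarPair_pow hr hpn
  rw [localFrobeniusLiarsPlus_eq_image hr, Set.ncard_image_of_injective _ quadPoly_injective,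
    ← Set.ncard_coe_finset]
  set φ := Prod.map (ZMod.castHom (dvd_pow_self p hr) (ZMod p))
    (ZMod.castHom (dvd_pow_self p hr) (ZMod p))
  rw [← (hbij.injOn.mono fun x hx => hx.1 : Set.InjOn φ _).ncard_image]
  congr 1
  ext y
  simp only [Finset.coe_filter, Finset.mem_univ, true_and, Set.mem_image, Set.mem_ofPred_eq]
  constructor
  · rintro ⟨x, ⟨hx, hκ⟩, rfl⟩
    exact ⟨hbij.mapsTo hx, hκ⟩
  · rintro ⟨hy, hκ⟩
    obtain ⟨x, hx, rfl⟩ := hbij.surjOn hy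
    exact ⟨x, ⟨hx, hκ⟩, rfl⟩

theorem ncard_frobeniusLiarsPlus (hn : 1 < n) (hcomp : ¬ n.Prime) :
    ((frobeniusLiarsPlus n).ncard : ℚ) =
      (1 / 2) * ∏ p ∈ n.primeFactors, (liarCountPlusPlus n p + liarCountPlusMinus n p) +
      (1 / 2) *
        (∏ p ∈ n.primeFactors with Even (n.factorization p),
          (liarCountPlusPlus n p + liarCountPlusMinus n p)) *
        (∏ p ∈ n.primeFactors with Odd (n.factorization p),
          (liarCountPlusPlus n p - liarCountPlusMinus n p)) := by
  have hn0 : n ≠ 0 := by omega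
  have hsum : ∀ j, (liarSum n j n : ℚ) = ∏ p ∈ n.primeFactors,
      (liarCountPlusPlus n p + (-1) ^ (n.factorization p * j) * liarCountPlusMinus n p) := by
    intro j
    rw [liarSum_eq_prod n j hn0, Int.cast_prod]
    refine Finset.prod_congr rfl fun p hp => ?_
    have : Fact p.Prime := ⟨Nat.prime_of_mem_primeFactors hp⟩
    refine liarSum_prime_pow_eq hn ?_ (Nat.ordProj_dvd n p) j
    rwa [← Finsupp.mem_support_iff, Nat.support_factorization]
  have h := congrArg (Int.cast : ℤ → ℚ) (two_mul_ncard_frobeniusLiarsPlus hn hcomp)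
  push_cast at h
  -- The sum with `j = 0` gives the first product. For `j = 1` the sign `(-1) ^ r` separates even
  -- from odd exponents.
  rw [hsum, hsum, ← Finset.prod_filter_mul_prod_filter_not n.primeFactors
    (fun p => Even (n.factorization p)) fun p => liarCountPlusPlus n p +
      (-1) ^ (n.factorization p * 1) * liarCountPlusMinus n p] at h
  simp only [mul_zero, pow_zero, one_mul, mul_one, Nat.not_even_iff_odd] at h
  have heven : ∏ p ∈ n.primeFactors with Even (n.factorization p),
      (liarCountPlusPlus n p + (-1) ^ n.factorization p * liarCountPlusMinus n p) =
      ∏ p ∈ n.primeFactors with Even (n.factorization p),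
        (liarCountPlusPlus n p + liarCountPlusMinus n p) :=
    Finset.prod_congr rfl fun p hp => by rw [(Finset.mem_filter.1 hp).2.neg_one_pow, one_mul]
  have hodd : ∏ p ∈ n.primeFactors with Odd (n.factorization p),
      (liarCountPlusPlus n p + (-1) ^ n.factorization p * liarCountPlusMinus n p) =
      ∏ p ∈ n.primeFactors with Odd (n.factorization p),
        (liarCountPlusPlus n p - liarCountPlusMinus n p) :=
    Finset.prod_congr rfl fun p hp => by
      rw [(Finset.mem_filter.1 hp).2.neg_one_pow, neg_one_mul, sub_eq_add_neg]
  rw [heven, hodd] at h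
  linear_combination h / 2

end Counting

theorem mainTheorem5 (n : ℕ) (hn : 1 < n) (hcomp : ¬ n.Prime) :
    -- the local counts
    (∀ p ∈ n.primeFactors,
      (localFrobeniusLiarsPlus n p (n.factorization p) 1).Finite ∧
      ((localFrobeniusLiarsPlus n p (n.factorization p) 1).ncard : ℚ) =
        liarCountPlusPlus n p ∧
      (localFrobeniusLiarsPlus n p (n.factorization p) (-1)).Finite ∧
      ((localFrobeniusLiarsPlus n p (n.factorization p) (-1)).ncard : ℚ) =
        liarCountPlusMinus n p) ∧
    -- the global count
    (frobeniusLiarsPlus n).Finite ∧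
    ((frobeniusLiarsPlus n).ncard : ℚ) =
      (1 / 2) * ∏ p ∈ n.primeFactors, (liarCountPlusPlus n p + liarCountPlusMinus n p) +
      (1 / 2) *
        (∏ p ∈ n.primeFactors with Even (n.factorization p),
          (liarCountPlusPlus n p + liarCountPlusMinus n p)) *
        (∏ p ∈ n.primeFactors with Odd (n.factorization p),
          (liarCountPlusPlus n p - liarCountPlusMinus n p)) ∧
    -- the squarefree case
    (Squarefree n →
      ((frobeniusLiarsPlus n).ncard : ℚ) =
        (1 / 2) * ∏ p ∈ n.primeFactors,
          ((1 / 2) * ((Nat.gcd (n - 1) (p ^ 2 - 1) : ℚ) + (Nat.gcd (n - 1) (p - 1) : ℚ) ^ 2 -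
            2 * (Nat.gcd (n - 1) (p - 1) : ℚ))) +
        (1 / 2) * ∏ p ∈ n.primeFactors,
          ((1 / 2) * ((Nat.gcd (n - 1) (p - 1) : ℚ) ^ 2 -
            (Nat.gcd (n - 1) (p ^ 2 - 1) : ℚ)))) := by
  refine ⟨fun p hp => ?_, frobeniusLiarsPlus_finite hn hcomp, ncard_frobeniusLiarsPlus hn hcomp,
    fun hsq => ?_⟩
  · have : Fact p.Prime := ⟨Nat.prime_of_mem_primeFactors hp⟩
    have hr : n.factorization p ≠ 0 := by
      rwa [← Finsupp.mem_support_iff, Nat.support_factorization]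
    have hpn := Nat.ordProj_dvd n p
    refine ⟨localFrobeniusLiarsPlus_finite hr 1, ?_, localFrobeniusLiarsPlus_finite hr (-1), ?_⟩
    · rw [ncard_localFrobeniusLiarsPlus hr hpn, card_liarPair_split hn]
    · rw [ncard_localFrobeniusLiarsPlus hr hpn, card_liarPair_inert hn]
  · have hfac : ∀ p ∈ n.primeFactors, n.factorization p = 1 := fun p hp =>
      Nat.factorization_eq_one_of_squarefree hsq (Nat.prime_of_mem_primeFactors hp)
        (Nat.dvd_of_mem_primeFactors hp)
    have hodd : (n.primeFactors.filter fun p => Odd (n.factorization p)) = n.primeFactors :=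
      Finset.filter_true_of_mem fun p hp => by rw [hfac p hp]; exact odd_one
    have heven : (n.primeFactors.filter fun p => Even (n.factorization p)) = ∅ :=
      Finset.filter_false_of_mem fun p hp => by rw [hfac p hp]; exact Nat.not_even_one
    rw [ncard_frobeniusLiarsPlus hn hcomp, hodd, heven, Finset.prod_empty, mul_one]
    congr 2
    · refine Finset.prod_congr rfl fun p _ => ?_
      rw [liarCountPlusPlus, liarCountPlusMinus]
      ring
    · refine Finset.prod_congr rfl fun p _ => ?_
      rw [liarCountPlusPlus, liarCountPlusMinus]
      ring
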